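/- Let $M$ be a right cancellative monoid (that is, $ac=bc$ implies $a=b$ for all $a,b,c\in M$) that is finitely generated and hyperbolic. Then $M$ does not contain $\mathbb{N}\times\mathbb{N}$ as a submonoid, i.e. no submonoid of $M$ is isomorphic to the additive monoid $\mathbb{N}\times\mathbb{N}$ (with $0\in\mathbb{N}$). Here the following notions are used. In a digraph $D$, a directed path of length $n$ from $x$ to $y$ is a sequence of vertices $x=x_0,\dots,x_n=y$ such that $(x_i,x_{i+1})$ is an edge for all $0\le i<n$. The distance $d(x,y)\in\mathbb{N}\cup\{\infty\}$ is the least length of a directed path from $x$ to $y$ ($\infty$ if there is none), and a geodesic from $x$ to $y$ is a directed path from $x$ to $y$ of length $d(x,y)$. For $\delta\ge 0$ and a set $A$ of vertices let $\mathcal{B}^+_\delta(A)$ be the set of vertices $v$ with $d(a,v)\le\delta$ for some $a\in A$, and let $\mathcal{B}^-_\delta(A)$ be the set of vertices $v$ with $d(v,a)\le\delta$ for some $a\in A$. A geodesic triangle consists of three (not necessarily distinct) vertices and three geodesics, its sides, one between every two of these vertices, each in one of the two possible directions. The digraph $D$ is hyperbolic if there is a $\delta\ge0$ such that for all vertices $x,y,z$,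 every geodesic $P$ from $x$ to $y$, every geodesic $Q$ from $x$ to $z$ or from $z$ to $x$, and every geodesic $R$ from $y$ to $z$ or from $z$ to $y$, every vertex of $P$ lies in $\mathcal{B}^+_\delta(Q)\cup\mathcal{B}^-_\delta(R)$. A finitely generated monoid $M$ is hyperbolic if for some finite generating set $S$ of $M$ its right Cayley digraph, which has vertex set $M$ and an edge from $m$ to $ms$ for all $m\in M$ and $s\in S$, is hyperbolic. -/

import Mathlib

open scoped NNReal ENNReal

namespace Digraph

variable {V : Type*} (D : Digraph V)

/-- `p 0, p 1, …, p n` is a directed path of length `n` from `x` to `y` in `D`.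
(The values of `p` beyond `n` are irrelevant.) -/
def IsDirectedPath (p : ℕ → V) (n : ℕ) (x y : V) : Prop :=
  p 0 = x ∧ p n = y ∧ ∀ i < n, D.Adj (p i) (p (i + 1))

/-- The directed distance from `x` to `y`: the least length of a directed path from `x` to `y`,
and `∞` if there is none. -/
noncomputable def ddist (x y : V) : ℕ∞ :=
  ⨅ (n : ℕ) (_ : ∃ p : ℕ → V, D.IsDirectedPath p n x y), (n : ℕ∞)

/-- `p 0, p 1, …, p n` is a geodesic from `x` to `y`, that is, a shortest directed path. -/
def IsGeodesic (p : ℕ → V) (n : ℕ) (x y : V) : Prop :=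
  D.IsDirectedPath p n x y ∧ (n : ℕ∞) = D.ddist x y

/-- The set `P` of vertices is the vertex set of a geodesic from `x` to `y`. -/
def IsGeodesicSet (P : Set V) (x y : V) : Prop :=
  ∃ (p : ℕ → V) (n : ℕ), D.IsGeodesic p n x y ∧ P = {v | ∃ i ≤ n, p i = v}

/-- The set `P` is the vertex set of a geodesic joining `x` and `y` in one of the two possible
directions. -/
def IsSide (P : Set V) (x y : V) : Prop :=
  D.IsGeodesicSet P x y ∨ D.IsGeodesicSet P y x

/-- The out-ball of radius `r` around a set `A` of vertices. -/
def outBall (r : ℝ≥0) (A : Set V) : Set V :=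
  {v | ∃ a ∈ A, (D.ddist a v : ℝ≥0∞) ≤ (r : ℝ≥0∞)}

/-- The in-ball of radius `r` around a set `A` of vertices. -/
def inBall (r : ℝ≥0) (A : Set V) : Set V :=
  {v | ∃ a ∈ A, (D.ddist v a : ℝ≥0∞) ≤ (r : ℝ≥0∞)}

/-- All geodesic triangles of `D` are `δ`-thin: whenever `P`, `Q`, `R` are the sides of a geodesic
triangle with end vertices `x`, `y`, `z`, where `P` is directed from `x` to `y`, the side `Q` joins
`x` and `z` (in either direction) and the side `R` joins `y` and `z` (in either direction), the
side `P` is contained in the union of the `δ`-out-ball around `Q` and the `δ`-in-ball around `R`. -/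
def IsDeltaHyperbolic (δ : ℝ≥0) : Prop :=
  ∀ (x y z : V) (P Q R : Set V),
    D.IsGeodesicSet P x y → D.IsSide Q x z → D.IsSide R y z →
      P ⊆ D.outBall δ Q ∪ D.inBall δ R

/-- A digraph is hyperbolic if it is `δ`-hyperbolic for some `δ ≥ 0`. -/
def IsHyperbolic : Prop :=
  ∃ δ : ℝ≥0, D.IsDeltaHyperbolic δ

end Digraph

/-- The right Cayley digraph of a monoid `M` with respect to a subset `S`: there is an edge from
`m` to `m * s` for all `m : M` and `s ∈ S`. -/
def rightCayleyDigraph {M : Type*} [Monoid M] (S : Set M) : Digraph M where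
  Adj m m' := ∃ s ∈ S, m * s = m'

/-- `M` is a finitely generated hyperbolic monoid: it has a finite generating set whose right
Cayley digraph is hyperbolic. -/
def IsFGHyperbolicMonoid (M : Type*) [Monoid M] : Prop :=
  ∃ S : Set M, S.Finite ∧ Submonoid.closure S = ⊤ ∧ (rightCayleyDigraph S).IsHyperbolic

/-! Right cancellation bounds in-balls as well as out-balls of the Cayley digraph, uniformly in the
centre (`exists_isBallBound`). With such balls and thin triangles, equally long geodesics whose ends
are joined by short geodesics fellow travel away from these, at comparable parameters
(`fellow_travel`).

If `ℕ × ℕ` embeds via `e`, some long geodesic `p` stays geodesic under left translation by every `e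
w` (`exists_isGeodesic_translates`). By commutativity, short paths lead from the ends of `p` to
those of its translate. Hence for all `w` in a `k × k` square, a vertex `p i` far from these paths
is close to some `e w * p j` with `|i - j|` linear in `k`. The pair `(j, e w * p j)` determines `w`
by right cancellation, but only linearly many pairs are available: fewer than `k ^ 2` for large `k`.
-/

namespace Digraph

variable {V : Type*} {D : Digraph V}

/-! ### Directed distance and geodesics. -/

/-- There is a directed path of length at most `r` from `x` to `y`. -/
def Within (D : Digraph V) (r : ℕ) (x y : V) : Prop :=
  ∃ n ≤ r, ∃ p : ℕ → V, D.IsDirectedPath p n x y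

theorem ddist_le_iff_within {r : ℕ} {x y : V} : D.ddist x y ≤ (r : ℕ∞) ↔ D.Within r x y := by
  constructor
  · intro h
    by_contra hc
    have h1 : ((r + 1 : ℕ) : ℕ∞) ≤ D.ddist x y := by
      refine le_iInf₂ fun n hn => ?_
      have : r < n := by
        by_contra hnr
        exact hc ⟨n, not_lt.mp hnr, hn⟩
      exact_mod_cast this
    have h2 := h1.trans h
    have h3 : r + 1 ≤ r := by exact_mod_cast h2
    omega
  · rintro ⟨n, hn, hp⟩
    exact (iInf₂_le n hp).trans (by exact_mod_cast hn)

theorem Within.mono {r s : ℕ} {x y : V} (h : D.Within r x y) (hrs : r ≤ s) : D.Within s x y := by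
  obtain ⟨n, hn, hp⟩ := h
  exact ⟨n, hn.trans hrs, hp⟩

theorem Within.refl (r : ℕ) (x : V) : D.Within r x x :=
  ⟨0, Nat.zero_le _, fun _ => x, rfl, rfl, fun i hi => absurd hi (Nat.not_lt_zero i)⟩

theorem Within.trans {r s : ℕ} {x y z : V} (h₁ : D.Within r x y) (h₂ : D.Within s y z) :
    D.Within (r + s) x z := by
  obtain ⟨n, hn, p, hp0, hpn, hp⟩ := h₁
  obtain ⟨m, hm, q, hq0, hqm, hq⟩ := h₂
  refine ⟨n + m, by omega, fun i => if i ≤ n then p i else q (i - n), ?_, ?_, ?_⟩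
  · simpa using hp0
  · by_cases h : m = 0
    · subst h
      simp [hpn, ← hqm, hq0]
    · simpa [h] using hqm
  · intro i hi
    rcases lt_trichotomy i n with h | h | h
    · simpa [h.le, Nat.succ_le_of_lt h] using hp i h
    · subst h
      have := hq 0 (by omega)
      simpa [hpn, ← hq0] using this
    · have := hq (i - n) (by omega)
      have e : i + 1 - n = i - n + 1 := by omega
      simpa [not_le.mpr h, show ¬ i + 1 ≤ n by omega, e] using this

theorem IsDirectedPath.segment {p : ℕ → V} {n : ℕ} {x y : V} (hp : D.IsDirectedPath p n x y)
    {i j : ℕ} (hij : i ≤ j) (hj : j ≤ n) :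
    D.IsDirectedPath (fun k => p (i + k)) (j - i) (p i) (p j) :=
  ⟨rfl, by simp [Nat.add_sub_cancel' hij], fun k hk => hp.2.2 (i + k) (by omega)⟩

theorem IsDirectedPath.within {p : ℕ → V} {n : ℕ} {x y : V} (hp : D.IsDirectedPath p n x y)
    {i j : ℕ} (hij : i ≤ j) (hj : j ≤ n) : D.Within (j - i) (p i) (p j) :=
  ⟨_, le_rfl, _, hp.segment hij hj⟩

theorem isGeodesic_iff {p : ℕ → V} {n : ℕ} {x y : V} :
    D.IsGeodesic p n x y ↔ D.IsDirectedPath p n x y ∧ ∀ r, D.Within r x y → n ≤ r := by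
  refine and_congr_right fun hp => ⟨fun h r hr => ?_, fun h => le_antisymm ?_ ?_⟩
  · have := ddist_le_iff_within.mpr hr
    rw [← h] at this
    exact_mod_cast this
  · exact le_iInf₂ fun m hm => by exact_mod_cast h m ⟨m, le_rfl, hm⟩
  · exact ddist_le_iff_within.mpr ⟨n, le_rfl, p, hp⟩

theorem Within.exists_isGeodesic {r : ℕ} {x y : V} (h : D.Within r x y) :
    ∃ p n, n ≤ r ∧ D.IsGeodesic p n x y := by
  classical
  have hex : ∃ r, D.Within r x y := ⟨r, h⟩
  obtain ⟨n, hn, p, hp⟩ := Nat.find_spec hex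
  exact ⟨p, n, hn.trans (Nat.find_min' hex h),
    isGeodesic_iff.mpr ⟨hp, fun s hs => hn.trans (Nat.find_min' hex hs)⟩⟩

theorem IsGeodesic.le_add {p : ℕ → V} {n : ℕ} {x y : V} (hp : D.IsGeodesic p n x y)
    {i j r : ℕ} (hi : i ≤ n) (hj : j ≤ n) (h : D.Within r (p i) (p j)) : j ≤ i + r := by
  obtain ⟨hpath, hmin⟩ := isGeodesic_iff.mp hp
  have h₁ := hpath.within (Nat.zero_le i) hi
  have h₂ := hpath.within hj le_rfl
  rw [hpath.1] at h₁
  rw [hpath.2.1] at h₂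
  have := hmin _ ((h₁.trans h).trans h₂)
  omega

theorem IsGeodesic.segment {p : ℕ → V} {n : ℕ} {x y : V} (hp : D.IsGeodesic p n x y)
    {i j : ℕ} (hij : i ≤ j) (hj : j ≤ n) :
    D.IsGeodesic (fun k => p (i + k)) (j - i) (p i) (p j) :=
  isGeodesic_iff.mpr ⟨hp.1.segment hij hj, fun r hr => by
    have := hp.le_add (hij.trans hj) hj hr
    omega⟩

theorem IsGeodesic.injOn {p : ℕ → V} {n : ℕ} {x y : V} (hp : D.IsGeodesic p n x y) :
    Set.InjOn p {i | i ≤ n} := by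
  intro i hi j hj hij
  have h₁ := hp.le_add hi hj (r := 0) (hij ▸ Within.refl 0 _)
  have h₂ := hp.le_add hj hi (r := 0) (hij ▸ Within.refl 0 _)
  omega

/-- A geodesic leaves every set of vertices that is not larger than its length. -/
theorem IsGeodesic.exists_notMem {p : ℕ → V} {n : ℕ} {x y : V}
    (hp : D.IsGeodesic p n x y) (Z : Finset V) (hZ : Z.card ≤ n) : ∃ i ≤ n, p i ∉ Z := by
  classical
  by_contra! hc
  have h₁ : ((Finset.range (n + 1)).image p).card = n + 1 := by
    rw [Finset.card_image_of_injOn, Finset.card_range]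
    intro i hi j hj hij
    exact hp.injOn (by simpa [Nat.lt_succ_iff] using hi) (by simpa [Nat.lt_succ_iff] using hj) hij
  have h₂ : (Finset.range (n + 1)).image p ⊆ Z := by
    intro v hv
    obtain ⟨i, hi, rfl⟩ := Finset.mem_image.mp hv
    exact hc i (by simpa [Nat.lt_succ_iff] using hi)
  have := Finset.card_le_card h₂
  omega

theorem isGeodesic_const (x : V) : D.IsGeodesic (fun _ => x) 0 x x :=
  isGeodesic_iff.mpr ⟨⟨rfl, rfl, fun i hi => absurd hi (Nat.not_lt_zero i)⟩,
    fun r _ => Nat.zero_le r⟩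

/-! ### Thin triangles and bounded balls. -/

/-- Thinness of geodesic triangles, with an integral constant and for parametrised sides. -/
def IsThin (D : Digraph V) (δ : ℕ) : Prop :=
  ∀ ⦃x y z : V⦄ ⦃p q r : ℕ → V⦄ ⦃n m k : ℕ⦄, D.IsGeodesic p n x y →
    (D.IsGeodesic q m x z ∨ D.IsGeodesic q m z x) →
    (D.IsGeodesic r k y z ∨ D.IsGeodesic r k z y) → ∀ i ≤ n,
      (∃ j ≤ m, D.Within δ (q j) (p i)) ∨ ∃ j ≤ k, D.Within δ (p i) (r j)

theorem within_ceil_of_ddist_le {δ : ℝ≥0} {x y : V} (h : (D.ddist x y : ℝ≥0∞) ≤ (δ : ℝ≥0∞)) :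
    D.Within ⌈δ⌉₊ x y := by
  have h₁ : (δ : ℝ≥0∞) ≤ ((⌈δ⌉₊ : ℕ) : ℝ≥0∞) := by
    exact_mod_cast Nat.le_ceil δ
  have h₂ := h.trans h₁
  rw [← ENat.toENNReal_coe, ENat.toENNReal_le] at h₂
  exact ddist_le_iff_within.mp h₂

theorem IsHyperbolic.exists_isThin (h : D.IsHyperbolic) : ∃ δ, D.IsThin δ := by
  obtain ⟨δ, hδ⟩ := h
  refine ⟨⌈δ⌉₊, fun x y z p q r n m k hp hq hr i hi => ?_⟩
  have hq' : D.IsSide {v | ∃ i ≤ m, q i = v} x z :=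
    hq.imp (fun h => ⟨q, m, h, rfl⟩) (fun h => ⟨q, m, h, rfl⟩)
  have hr' : D.IsSide {v | ∃ i ≤ k, r i = v} y z :=
    hr.imp (fun h => ⟨r, k, h, rfl⟩) (fun h => ⟨r, k, h, rfl⟩)
  rcases hδ x y z _ _ _ ⟨p, n, hp, rfl⟩ hq' hr' ⟨i, hi, rfl⟩ with h | h
  · obtain ⟨_, ⟨j, hj, rfl⟩, h⟩ := h
    exact Or.inl ⟨j, hj, within_ceil_of_ddist_le h⟩
  · obtain ⟨_, ⟨j, hj, rfl⟩, h⟩ := h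
    exact Or.inr ⟨j, hj, within_ceil_of_ddist_le h⟩

/-- `F x` contains all vertices at distance at most `δ` from or to `x`, and has at most `N`
elements. -/
structure IsBallBound (D : Digraph V) (δ N : ℕ) (F : V → Finset V) : Prop where
  card_le : ∀ x, (F x).card ≤ N
  out_mem : ∀ {x y}, D.Within δ x y → y ∈ F x
  in_mem : ∀ {x y}, D.Within δ x y → x ∈ F y

theorem card_le_of_near {δ N : ℕ} {F : V → Finset V} (hF : D.IsBallBound δ N F) {p q : ℕ → V}
    {n m : ℕ} (hp : Set.InjOn p {i | i ≤ n}) (I : Finset ℕ) (hI : ∀ i ∈ I, i ≤ n)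
    (h : ∀ i ∈ I, ∃ j ≤ m, p i ∈ F (q j)) : I.card ≤ (m + 1) * N := by
  classical
  have hsub : I.image p ⊆ (Finset.range (m + 1)).biUnion fun j => F (q j) := by
    intro v hv
    obtain ⟨i, hi, rfl⟩ := Finset.mem_image.mp hv
    obtain ⟨j, hj, hij⟩ := h i hi
    exact Finset.mem_biUnion.mpr ⟨j, Finset.mem_range.mpr (by omega), hij⟩
  calc I.card = (I.image p).card :=
        (Finset.card_image_of_injOn fun i hi j hj => hp (hI i hi) (hI j hj)).symm
    _ ≤ _ := Finset.card_le_card hsub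
    _ ≤ (Finset.range (m + 1)).card * N :=
        Finset.card_biUnion_le_card_mul _ _ _ fun j _ => hF.card_le _
    _ = _ := by simp

/-- If one can return from the end of a geodesic to its start quickly, then it is short. -/
theorem IsThin.length_le_of_within {δ N : ℕ} {F : V → Finset V} (hD : D.IsThin δ)
    (hF : D.IsBallBound δ N F) {p : ℕ → V} {n K : ℕ} {x y : V} (hp : D.IsGeodesic p n x y)
    (h : D.Within K y x) : n ≤ (K + 2) * N := by
  classical
  obtain ⟨q, m, hm, hq⟩ := h.exists_isGeodesic
  -- The third side is constant at `y`; appending `y` to `q` as index `m + 1` merges both cases of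
  -- thinness.
  have key := card_le_of_near hF (q := fun j => if j ≤ m then q j else y) (m := m + 1) hp.injOn
    (Finset.range (n + 1)) (fun i hi => by simpa [Nat.lt_succ_iff] using hi) (fun i hi => by
      have hi' : i ≤ n := by simpa [Nat.lt_succ_iff] using hi
      rcases hD hp (Or.inr hq) (Or.inl (isGeodesic_const y)) i hi' with ⟨j, hj, h⟩ | ⟨j, -, h⟩
      · exact ⟨j, by omega, by simpa [hj] using hF.out_mem h⟩
      · exact ⟨m + 1, le_rfl, by simpa using hF.in_mem h⟩)
  rw [Finset.card_range] at key
  have : (m + 1 + 1) * N ≤ (K + 2) * N := Nat.mul_le_mul_right _ (by omega)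
  omega

theorem IsThin.le_add_of_within {δ N : ℕ} {F : V → Finset V} (hD : D.IsThin δ)
    (hF : D.IsBallBound δ N F) {p : ℕ → V} {n K i j : ℕ} {x y : V} (hp : D.IsGeodesic p n x y)
    (hj : j ≤ n) (h : D.Within K (p j) (p i)) : j ≤ i + (K + 2) * N := by
  rcases le_total j i with hji | hij
  · omega
  · have := hD.length_le_of_within hF (hp.segment hij hj) h
    omega

/-- In a geodesic triangle with sides from `x` to `y`, from `x` to `z` and from `y` to `z`, the
first side is not much longer than the second one if the third one is short. -/
theorem IsThin.length_le_add {δ N : ℕ} {F : V → Finset V} (hD : D.IsThin δ)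
    (hF : D.IsBallBound δ N F) {p s r : ℕ → V} {n m l : ℕ} {x y z : V}
    (hp : D.IsGeodesic p n x y) (hs : D.IsGeodesic s m x z) (hr : D.IsGeodesic r l y z) :
    n ≤ m + δ + (l + 1) * N := by
  classical
  by_contra hc
  -- Vertices of `p` beyond `m + δ` cannot be near `s`, as this would give a shortcut from `x`; so
  -- all are near `r`.
  have key := card_le_of_near hF (q := r) (m := l) hp.injOn (Finset.Icc (m + δ + 1) n)
    (fun i hi => (Finset.mem_Icc.mp hi).2) (fun i hi => by
      obtain ⟨hi₁, hi₂⟩ := Finset.mem_Icc.mp hi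
      rcases hD hp (Or.inl hs) (Or.inl hr) i hi₂ with ⟨t, ht, h⟩ | ⟨j, hj, h⟩
      · have h' := (hs.1.within (Nat.zero_le t) ht).trans h
        rw [hs.1.1, ← hp.1.1] at h'
        have := hp.le_add (Nat.zero_le n) hi₂ h'
        omega
      · exact ⟨j, hj, hF.in_mem h⟩)
  rw [Nat.card_Icc] at key
  omega

/-- Two geodesics of the same length whose starts and ends are joined by short geodesics `q` and
`r` fellow travel outside of a neighbourhood of these two geodesics. -/
theorem IsThin.fellow_travel {δ N : ℕ} {F : V → Finset V} (hD : D.IsThin δ)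
    (hF : D.IsBallBound δ N F) {p p' q r : ℕ → V} {n l k L : ℕ} {x y x' y' : V}
    (hp : D.IsGeodesic p n x y) (hp' : D.IsGeodesic p' n x' y')
    (hq : D.IsGeodesic q l x x') (hr : D.IsGeodesic r k y y') (hl : l ≤ L) (hk : k ≤ L)
    {i : ℕ} (hi : i ≤ n)
    (hiq : ∀ a ≤ l, ∀ v ∈ F (q a), ∀ w ∈ F v, p i ∉ F w)
    (hir : ∀ a ≤ k, ∀ v ∈ F (r a), ∀ w ∈ F v, p i ∉ F w) :
    ∃ j ≤ n, (∃ d, D.Within δ d (p i) ∧ D.Within δ d (p' j)) ∧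
      i ≤ j + ((N + 1) * L + (3 * δ + (2 * δ + 3) * N)) ∧
      j ≤ i + ((N + 1) * L + (3 * δ + (2 * δ + 3) * N)) := by
  have hself : ∀ v, v ∈ F v := fun v => hF.out_mem (Within.refl δ v)
  have hxy' : D.Within (l + n) x y' := by
    have h₁ := hq.1.within (Nat.zero_le l) le_rfl
    have h₂ := hp'.1.within (Nat.zero_le n) le_rfl
    rw [hq.1.1, hq.1.2.1] at h₁
    rw [hp'.1.1, hp'.1.2.1] at h₂
    exact h₁.trans h₂
  -- The diagonal `s` splits the quadrilateral into two triangles.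
  obtain ⟨s, m, -, hs⟩ := hxy'.exists_isGeodesic
  have hnm := hD.length_le_add hF hp hs hr
  obtain ⟨t, ht, hti⟩ : ∃ t ≤ m, D.Within δ (s t) (p i) := by
    rcases hD hp (Or.inl hs) (Or.inl hr) i hi with h | ⟨a, ha, h⟩
    · exact h
    · exact absurd (hF.in_mem h) (hir a ha _ (hself _) _ (hself _))
  -- Being near is directed: `hti` bounds `i` by `t`, and the reverse bound needs a path from `p` to
  -- `s t`. The same holds for `t'` below.
  obtain ⟨i₂, hi₂, hi₂t⟩ : ∃ i₂ ≤ n, D.Within δ (p i₂) (s t) := by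
    rcases hD hs (Or.inl hp) (Or.inr hr) t ht with h | ⟨a, ha, h⟩
    · exact h
    · exact absurd (hF.out_mem hti) (hir a ha _ (hself _) _ (hF.in_mem h))
  obtain ⟨j, hj, htj⟩ : ∃ j ≤ n, D.Within δ (s t) (p' j) := by
    rcases hD hs (Or.inl hq) (Or.inr hp') t ht with ⟨a, ha, h⟩ | h
    · exact absurd (hF.out_mem hti) (hiq a ha _ (hself _) _ (hF.out_mem h))
    · exact h
  obtain ⟨t', ht', hjt'⟩ : ∃ t' ≤ m, D.Within δ (p' j) (s t') := by
    rcases hD hp' (Or.inr hq) (Or.inr hs) j hj with ⟨a, ha, h⟩ | h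
    · exact absurd (hF.out_mem hti) (hiq a ha _ (hF.out_mem h) _ (hF.in_mem htj))
    · exact h
  have b₁ : i ≤ t + δ := by
    have h := (hs.1.within (Nat.zero_le t) ht).trans hti
    rw [hs.1.1, ← hp.1.1] at h
    have := hp.le_add (Nat.zero_le n) hi h
    omega
  have b₂ : t ≤ i₂ + δ := by
    have h := (hp.1.within (Nat.zero_le i₂) hi₂).trans hi₂t
    rw [hp.1.1, ← hs.1.1] at h
    have := hs.le_add (Nat.zero_le m) ht h
    omega
  have b₃ := hD.le_add_of_within hF hp hi₂ (hi₂t.trans hti)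
  have b₄ : m ≤ t + (δ + (n - j)) := by
    have h := htj.trans (hp'.1.within hj le_rfl)
    rw [hp'.1.2.1, ← hs.1.2.1] at h
    exact hs.le_add ht le_rfl h
  have b₅ : t' ≤ l + j + δ := by
    have h₁ := hq.1.within (Nat.zero_le l) le_rfl
    have h₂ := hp'.1.within (Nat.zero_le j) hj
    rw [hq.1.1, hq.1.2.1] at h₁
    rw [hp'.1.1] at h₂
    have h := (h₁.trans h₂).trans hjt'
    rw [← hs.1.1] at h
    have := hs.le_add (Nat.zero_le m) ht' h
    omega
  have b₆ := hD.le_add_of_within hF hs ht (htj.trans hjt')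
  have b₇ : (k + 1) * N ≤ (L + 1) * N := Nat.mul_le_mul_right _ (by omega)
  have b₈ : n - j + j = n := Nat.sub_add_cancel hj
  refine ⟨j, hj, ⟨s t, hti, htj⟩, ?_, ?_⟩ <;> nlinarith

end Digraph

/-! ### Cayley digraphs and copies of `ℕ × ℕ`. -/

section Cayley

open Digraph

theorem exists_within_mul {M : Type*} [Monoid M] {S : Set M} (hS : Submonoid.closure S = ⊤)
    (m : M) : ∃ r, ∀ x, (rightCayleyDigraph S).Within r x (x * m) := by
  have hm : m ∈ Submonoid.closure S := hS ▸ Submonoid.mem_top m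
  induction hm using Submonoid.closure_induction with
  | mem s hs =>
    refine ⟨1, fun x => ⟨1, le_rfl, fun i => if i = 0 then x else x * s, by simp, by simp, ?_⟩⟩
    intro i hi
    obtain rfl : i = 0 := by omega
    exact ⟨s, hs, by simp⟩
  | one => exact ⟨0, fun x => by simpa using Within.refl 0 x⟩
  | mul a b _ _ ha hb =>
    obtain ⟨r, hr⟩ := ha
    obtain ⟨t, ht⟩ := hb
    exact ⟨r + t, fun x => by simpa [mul_assoc] using (hr x).trans (ht (x * a))⟩

open scoped Pointwise in
theorem exists_finset_of_within {M : Type*} [Monoid M] {S : Set M} (hS : S.Finite) (r : ℕ) :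
    ∃ B : Finset M, ∀ x y, (rightCayleyDigraph S).Within r x y → ∃ s ∈ B, x * s = y := by
  classical
  set A : Finset M := insert 1 hS.toFinset with hA
  refine ⟨A ^ r, ?_⟩
  rintro x y ⟨n, hn, p, h0, hn', hp⟩
  have key : ∀ i ≤ n, ∃ s ∈ A ^ i, x * s = p i := by
    intro i hi
    induction i with
    | zero => exact ⟨1, by simp, by simp [h0]⟩
    | succ i ih =>
      obtain ⟨s, hs, h⟩ := ih (by omega)
      obtain ⟨t, ht, h'⟩ := hp i (by omega)
      refine ⟨s * t, ?_, by rw [← mul_assoc, h, h']⟩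
      rw [pow_succ]
      exact Finset.mul_mem_mul hs (by simp [hA, ht])
  obtain ⟨s, hs, h⟩ := key n le_rfl
  exact ⟨s, Finset.pow_subset_pow_right (by simp [hA]) hn hs, h.trans hn'⟩

/-- Right cancellation bounds the size of balls in the Cayley digraph, in both directions. -/
theorem exists_isBallBound {M : Type*} [RightCancelMonoid M] {S : Set M} (hS : S.Finite) (δ : ℕ) :
    ∃ N F, (rightCayleyDigraph S).IsBallBound δ N F := by
  classical
  obtain ⟨B, hB⟩ := exists_finset_of_within hS δ
  refine ⟨B.card + B.card, fun x => B.image (fun s => x * s) ∪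
    B.image (fun s => if h : ∃ y, y * s = x then h.choose else 1), ⟨fun x => ?_, ?_, ?_⟩⟩
  · exact (Finset.card_union_le _ _).trans
      (Nat.add_le_add Finset.card_image_le Finset.card_image_le)
  · intro x y h
    obtain ⟨s, hs, h⟩ := hB x y h
    exact Finset.mem_union_left _ (Finset.mem_image.mpr ⟨s, hs, h⟩)
  · intro x y h
    obtain ⟨s, hs, h⟩ := hB x y h
    refine Finset.mem_union_right _ (Finset.mem_image.mpr ⟨s, hs, ?_⟩)
    have hex : ∃ z, z * s = y := ⟨x, h⟩
    rw [dif_pos hex]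
    exact mul_right_cancel (hex.choose_spec.trans h.symm)

variable {M : Type*} [RightCancelMonoid M] {S : Set M} {e : ℕ × ℕ → M}

theorem map_commute (he : ∀ g h, e (g + h) = e g * e h) (g h : ℕ × ℕ) :
    e g * e h = e h * e g := by
  rw [← he, ← he, add_comm]

theorem map_zero_eq_one (he : ∀ g h, e (g + h) = e g * e h) : e 0 = 1 :=
  mul_right_cancel (b := e 0) (by rw [← he, one_mul, add_zero])

/-- The word length on a copy of `ℕ × ℕ` grows at most linearly. -/
theorem exists_within_mul_map (hS : Submonoid.closure S = ⊤)
    (he : ∀ g h, e (g + h) = e g * e h) :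
    ∃ c, ∀ g x, (rightCayleyDigraph S).Within ((g.1 + g.2) * c) x (x * e g) := by
  obtain ⟨c₁, h₁⟩ := exists_within_mul hS (e (1, 0))
  obtain ⟨c₂, h₂⟩ := exists_within_mul hS (e (0, 1))
  have a₁ : ∀ s x, (rightCayleyDigraph S).Within (s * max c₁ c₂) x (x * e (s, 0)) := by
    intro s
    induction s with
    | zero =>
      intro x
      have : e (0, 0) = 1 := map_zero_eq_one he
      simpa [this] using Within.refl _ x
    | succ s ih =>
      intro x
      have : e (s + 1, 0) = e (s, 0) * e (1, 0) := by rw [← he]; rfl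
      rw [this, ← mul_assoc, Nat.succ_mul]
      exact (ih x).trans ((h₁ _).mono (le_max_left _ _))
  have a₂ : ∀ s x, (rightCayleyDigraph S).Within (s * max c₁ c₂) x (x * e (0, s)) := by
    intro s
    induction s with
    | zero =>
      intro x
      have : e (0, 0) = 1 := map_zero_eq_one he
      simpa [this] using Within.refl _ x
    | succ s ih =>
      intro x
      have : e (0, s + 1) = e (0, s) * e (0, 1) := by rw [← he]; rfl
      rw [this, ← mul_assoc, Nat.succ_mul]
      exact (ih x).trans ((h₂ _).mono (le_max_right _ _))
  refine ⟨max c₁ c₂, fun g x => ?_⟩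
  have : e g = e (g.1, 0) * e (0, g.2) := by rw [← he]; simp
  rw [this, ← mul_assoc, Nat.add_mul]
  exact (a₁ _ x).trans (a₂ _ _)

/-- Translations of a copy of `ℕ × ℕ` by multiples of `(1, 0)` move all its elements far. -/
theorem exists_forall_not_within (hS : S.Finite) (he : ∀ g h, e (g + h) = e g * e h)
    (he' : Function.Injective e) (G : ℕ) :
    ∃ n, ∀ g, ¬ (rightCayleyDigraph S).Within G (e g) (e g * e (n, 0)) := by
  by_contra! hc
  obtain ⟨B, hB⟩ := exists_finset_of_within hS G
  have hs : ∀ n, ∃ s : B, ∃ g, e g * s = e g * e (n, 0) := fun n => by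
    obtain ⟨g, hg⟩ := hc n
    obtain ⟨s, hs, h⟩ := hB _ _ hg
    exact ⟨⟨s, hs⟩, g, h⟩
  choose s g hsg using hs
  -- Two translations share the factor `s`. As `M` need not be left cancellative, the cancellation
  -- is done in `ℕ × ℕ`.
  obtain ⟨n, m, hnm, hsnm⟩ := Finite.exists_ne_map_eq_of_infinite s
  have h₁ : e (g m + (g n + (n, 0))) = e (g n + (g m + (m, 0))) := by
    rw [he, he, ← hsg n, hsnm, he, he, ← hsg m, ← mul_assoc, ← mul_assoc, map_commute he (g m)]
  have h₂ := he' h₁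
  rw [add_left_comm] at h₂
  have h₃ := add_left_cancel (add_left_cancel h₂)
  exact hnm (Prod.ext_iff.mp h₃).1

/-- There are arbitrarily long geodesics between elements of a copy of `ℕ × ℕ` all of whose
translates by elements of this copy are geodesics. -/
theorem exists_isGeodesic_translates (hS : S.Finite) (hS' : Submonoid.closure S = ⊤)
    (he : ∀ g h, e (g + h) = e g * e h) (he' : Function.Injective e) (G : ℕ) :
    ∃ n > G, ∃ (g h : ℕ × ℕ) (p : ℕ → M), ∀ w, (rightCayleyDigraph S).IsGeodesic (fun i => e w * p i) n
      (e w * e g) (e w * (e g * e h)) := by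
  classical
  obtain ⟨k, hk⟩ := exists_forall_not_within hS he he' G
  -- Minimising over all `g` at once makes the translates geodesic: a shorter path for `w` would
  -- beat the minimum at `w + g`.
  have hex : ∃ r, ∃ g, (rightCayleyDigraph S).Within r (e g) (e g * e (k, 0)) := by
    obtain ⟨r, hr⟩ := exists_within_mul hS' (e (k, 0))
    exact ⟨r, 0, hr _⟩
  have hmin := fun r h => Nat.find_min' hex (m := r) h
  obtain ⟨g, hg⟩ := Nat.find_spec hex
  set n := Nat.find hex
  obtain ⟨m, hm, p, hp⟩ := hg
  have hmn : m = n := le_antisymm hm (hmin m ⟨g, m, le_rfl, p, hp⟩)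
  rw [hmn] at hp
  refine ⟨n, ?_, g, (k, 0), p, fun w => isGeodesic_iff.mpr ⟨⟨?_, ?_, ?_⟩, fun r hr => ?_⟩⟩
  · by_contra h
    exact hk g ⟨n, not_lt.mp h, p, hp⟩
  · simp [hp.1]
  · simp [hp.2.1]
  · intro i hi
    obtain ⟨s, hs, h⟩ := hp.2.2 i hi
    exact ⟨s, hs, by simp [mul_assoc, h]⟩
  · refine hmin r ⟨w + g, ?_⟩
    rwa [he, mul_assoc]

/-- A right Cayley digraph of a right cancellative monoid containing `ℕ × ℕ` is not hyperbolic: the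
`k ^ 2` translates of a long geodesic by small elements would all have to come close to a fixed
vertex, within a segment of length linear in `k`. -/
theorem not_isThin_of_injective (hS : S.Finite) (hS' : Submonoid.closure S = ⊤)
    (he : ∀ g h, e (g + h) = e g * e h) (he' : Function.Injective e) (δ : ℕ) :
    ¬ (rightCayleyDigraph S).IsThin δ := by
  classical
  intro hD
  obtain ⟨N, F, hF⟩ := exists_isBallBound hS δ
  obtain ⟨c, hc⟩ := exists_within_mul_map hS' he
  set β := 3 * δ + (2 * δ + 3) * N with hβ
  -- Chosen so that `k * k` exceeds the final count of pairs, which is linear in `k` through `L`.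
  set k := 4 * (N + 1) * c * (N * N) + (2 * β + 1) * (N * N) + 1 with hk
  set L := (k + k) * c with hL
  set W : Finset (ℕ × ℕ) := Finset.range k ×ˢ Finset.range k with hW
  obtain ⟨n, hn, g, h, p, hp⟩ := exists_isGeodesic_translates hS hS' he he'
    (W.card * ((L + 1) * (N * (N * N) + N * (N * N))))
  have hp₀ := hp 0
  simp only [map_zero_eq_one he, one_mul] at hp₀
  have hside : ∀ w, ∀ x, ∃ q l, (w ∈ W → l ≤ L) ∧
      (rightCayleyDigraph S).IsGeodesic q l x (x * e w) := by
    intro w x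
    obtain ⟨q, l, hl, hq⟩ := (hc w x).exists_isGeodesic
    refine ⟨q, l, fun hw => hl.trans (Nat.mul_le_mul_right _ ?_), hq⟩
    have := Finset.mem_product.mp hw
    simp only [Finset.mem_range] at this
    omega
  choose q l hl hq using hside
  -- Three nested balls, as `fellow_travel` requires; `p` is long enough to leave all of these sets
  -- around the connecting geodesics.
  let T : M → Finset M := fun z => (F z).biUnion fun v => (F v).biUnion F
  have hT : ∀ z, (T z).card ≤ N * (N * N) := fun z => by
    refine (Finset.card_biUnion_le_card_mul _ _ (N * N) fun v _ => ?_).trans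
      (Nat.mul_le_mul_right _ (hF.card_le z))
    exact (Finset.card_biUnion_le_card_mul _ _ N fun w _ => hF.card_le w).trans
      (Nat.mul_le_mul_right _ (hF.card_le v))
  obtain ⟨i, hi, hiZ⟩ := hp₀.exists_notMem (W.biUnion fun w => (Finset.range (L + 1)).biUnion
      fun a => T (q w (e g) a) ∪ T (q w (e g * e h) a)) (by
    refine le_trans ?_ hn.le
    refine Finset.card_biUnion_le_card_mul _ _ _ fun w _ => ?_
    refine (Finset.card_biUnion_le_card_mul _ _ (N * (N * N) + N * (N * N)) fun a _ => ?_).trans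
      (by rw [Finset.card_range])
    exact (Finset.card_union_le _ _).trans (Nat.add_le_add (hT _) (hT _)))
  have hiW : ∀ w ∈ W, ∀ a ≤ L, p i ∉ T (q w (e g) a) ∧ p i ∉ T (q w (e g * e h) a) := by
    intro w hw a ha
    rw [← not_or, ← Finset.mem_union]
    intro hm
    exact hiZ (Finset.mem_biUnion.mpr ⟨w, hw, Finset.mem_biUnion.mpr
      ⟨a, Finset.mem_range.mpr (by omega), hm⟩⟩)
  have hTi : ∀ z, p i ∉ T z → ∀ v ∈ F z, ∀ w ∈ F v, p i ∉ F w := fun z hz v hv w hw hm =>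
    hz (Finset.mem_biUnion.mpr ⟨v, hv, Finset.mem_biUnion.mpr ⟨w, hw, hm⟩⟩)
  have htravel : ∀ w, ∃ j, w ∈ W → (e w * p j ∈ (F (p i)).biUnion F ∧
      j ∈ Finset.Icc (i - ((N + 1) * L + β)) (i + ((N + 1) * L + β))) := by
    intro w
    by_cases hw : w ∈ W
    swap
    · exact ⟨0, fun h => absurd h hw⟩
    have hq₁ := hq w (e g)
    have hq₂ := hq w (e g * e h)
    -- Commutativity turns right multiples of the ends of `p` into the ends of its left translate.
    rw [map_commute he g w] at hq₁
    rw [← he g h, map_commute he (g + h) w, he g h] at hq₂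
    obtain ⟨j, -, ⟨d, hd₁, hd₂⟩, hj₁, hj₂⟩ := hD.fellow_travel hF hp₀ (hp w) hq₁ hq₂
      (hl w _ hw) (hl w _ hw) hi
      (fun a ha => hTi _ (hiW w hw a (ha.trans (hl w _ hw))).1)
      (fun a ha => hTi _ (by
        simpa only [he] using (hiW w hw a (ha.trans (hl w _ hw))).2))
    refine ⟨j, fun _ => ⟨Finset.mem_biUnion.mpr ⟨d, hF.in_mem hd₁, hF.out_mem hd₂⟩, ?_⟩⟩
    rw [Finset.mem_Icc]
    omega
  choose j hj using htravel
  have hcard : W.card ≤ (Finset.Icc (i - ((N + 1) * L + β)) (i + ((N + 1) * L + β)) ×ˢ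
      (F (p i)).biUnion F).card := by
    refine Finset.card_le_card_of_injOn (fun w => (j w, e w * p (j w)))
      (fun w hw => Finset.mem_product.mpr ⟨(hj w hw).2, (hj w hw).1⟩) ?_
    intro w _ w' _ hww'
    obtain ⟨h₁, h₂⟩ := Prod.ext_iff.mp hww'
    simp only at h₁ h₂
    rw [h₁] at h₂
    exact he' (mul_right_cancel h₂)
  rw [Finset.card_product, Finset.card_product, Finset.card_range, Nat.card_Icc] at hcard
  have hcard' : k * k ≤ (2 * ((N + 1) * L + β) + 1) * (N * N) := by
    refine hcard.trans (Nat.mul_le_mul (by omega) ?_)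
    exact (Finset.card_biUnion_le_card_mul _ _ N fun w _ => hF.card_le w).trans
      (Nat.mul_le_mul_right _ (hF.card_le _))
  have hexp : (2 * ((N + 1) * L + β) + 1) * (N * N)
      = k * (4 * (N + 1) * c * (N * N)) + (2 * β + 1) * (N * N) := by
    rw [hL]
    ring
  have hk' : k * k = k * (4 * (N + 1) * c * (N * N)) + k * ((2 * β + 1) * (N * N)) + k := by
    conv_lhs => enter [2]; rw [hk]
    ring
  have hk₁ : 1 ≤ k := by omega
  have := Nat.mul_le_mul_right ((2 * β + 1) * (N * N)) hk₁
  omega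

end Cayley

theorem mainTheorem2 (M : Type*) [RightCancelMonoid M] (hM : IsFGHyperbolicMonoid M) :
    ¬ ∃ N : Submonoid M, Nonempty (N ≃* Multiplicative (ℕ × ℕ)) := by
  rintro ⟨N, ⟨φ⟩⟩
  obtain ⟨S, hS, hS', hhyp⟩ := hM
  obtain ⟨δ, hδ⟩ := hhyp.exists_isThin
  refine not_isThin_of_injective (e := fun g => (φ.symm (Multiplicative.ofAdd g) : M)) hS hS'
    (fun g h => by rw [ofAdd_add, map_mul, Submonoid.coe_mul]) (fun g h hgh => ?_) δ hδ
  exact Multiplicative.ofAdd.injective (φ.symm.injective (Subtype.ext hgh))
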